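/- For $j\in\{0,\tfrac12,1,\dots\}$ let $U^{(j)}$ be the $(2j+1)$-dimensional (spin-$j$) irreducible unitary representation of $\mathrm{SU}(2)$. Consider representations $U$ of $\mathrm{SU}(2)$ that are orthogonal direct sums of copies of the $U^{(j)}$ with arbitrary multiplicities, with orthonormal basis $|j,m,\alpha\rangle$ ($m=-j,\dots,j$, and $\alpha$ a multiplicity index). A pure state is a unit vector $|\psi\rangle=\sum_{j,m,\alpha}\psi_{j,m,\alpha}|j,m,\alpha\rangle$; its characteristic function is $\chi_\psi(g)=\langle\psi|U_g|\psi\rangle$ for $g\in \mathrm{SU}(2)$. With $\Pi_j=\sum_{\alpha}\sum_{m}|j,m,\alpha\rangle\langle j,m,\alpha|$, a spin $j$ is occupied in $\psi$ if $\operatorname{tr}(\Pi_j|\psi\rangle\langle\psi|\Pi_j)>0$, and $j_{\max}(\psi)$ is the maximal occupied spin, which exists when the set of occupied spins is bounded ("$\psi$ has finite maximal spin"). **Proposition.** Let $\psi,\phi$ be pure states of such representations (the states below may belong to different representations). 1. (Deterministic criterion.) Suppose $\psi$ has finite maximal spin and $\xi$ is a pure state with $\chi_\psi(g)=\chi_\xi(g)\,\chi_\phi(g)$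 for all $g\in\mathrm{SU}(2)$. Then $\phi$ and $\xi$ have finite maximal spin and $$j_{\max}(\xi)\le j_{\max}(\psi)-j_{\max}(\phi).$$ 2. (Probabilistic criterion.) Suppose $\psi$ has finite maximal spin, $0<p<1$, and $\xi,\sigma$ are pure states with $\chi_\psi(g)=p\,\chi_\xi(g)\,\chi_\phi(g)+(1-p)\,\chi_\sigma(g)$ for all $g\in\mathrm{SU}(2)$. Then $\phi,\xi,\sigma$ have finite maximal spin and $$j_{\max}(\xi)\le j_{\max}(\psi)-j_{\max}(\phi),\qquad j_{\max}(\sigma)\le j_{\max}(\psi).$$ 3. The maximal occupied spin cannot increase under probabilistic pure-state transformations: if the representations of $\psi$ and $\phi$ are finite-dimensional, $p>0$, and there is an $\mathrm{SU}(2)$-covariant quantum operation $\mathcal E$ (a completely positive, trace-non-increasing linear map with $\mathcal E(U_g\rho U_g^\dagger)=U_g\mathcal E(\rho)U_g^\dagger$ for all $g$ and $\rho$) with $\mathcal E(|\psi\rangle\langle\psi|)=p\,|\phi\rangle\langle\phi|$, then $j_{\max}(\phi)\le j_{\max}(\psi)$. -/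

import Mathlib

open scoped BigOperators ComplexConjugate ComplexOrder

noncomputable section

namespace SpinCovariance

/-- The group `SU(2)`. An element is `!![u, -v*; v, u*]` with `u = g 0 0`, `v = g 1 0`. -/
abbrev SU2 : Type := Matrix.specialUnitaryGroup (Fin 2) ℂ

/-- The matrix `U^{(j)}(g)` of the spin-`j` irreducible representation, `j = n / 2`, in the
orthonormal basis `|j, m⟩`; the index `k : Fin (n + 1)` stands for `m = j - k`, so `k = j - m`
and `n - k = j + m`. The row is `m' = j - k'`, the column is `m = j - k`, and
`U^{(j)}_{m',m} = √(C(2j, j-m) / C(2j, j-m')) ∑_a C(j-m, a) C(j+m, m-m'+a)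
  (-1)^a u^{j+m'-a} (u*)^{j-m-a} v^{m-m'+a} (v*)^a`,
where `a` runs from `max 0 (m'-m)` to `min (j-m) (j+m')`. -/
def spinMatrix (n : ℕ) (g : SU2) : Matrix (Fin (n + 1)) (Fin (n + 1)) ℂ :=
  Matrix.of fun k' k =>
    let u : ℂ := g.1 0 0
    let v : ℂ := g.1 1 0
    (Real.sqrt ((n.choose k : ℝ) / (n.choose k' : ℝ)) : ℂ) *
      ∑ a ∈ Finset.Icc ((k : ℕ) - (k' : ℕ)) (min (k : ℕ) (n - (k' : ℕ))),
        ((k : ℕ).choose a : ℂ) * ((n - (k : ℕ)).choose ((k' : ℕ) + a - (k : ℕ)) : ℂ) *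
          (-1) ^ a * u ^ (n - (k' : ℕ) - a) * (conj u) ^ ((k : ℕ) - a) *
          v ^ ((k' : ℕ) + a - (k : ℕ)) * (conj v) ^ a

/-- Labels `(j, α, m)` of the basis vectors `|j, m, α⟩` of the representation of `SU(2)` that
contains the spin-`n/2` irrep with multiplicity index set `A n`. A label is
`⟨⟨n, α⟩, k⟩` with `j = n / 2` and `m = j - k`. -/
abbrev SpinIndex (A : ℕ → Type*) : Type _ := (x : Σ n, A n) × Fin (x.1 + 1)

open Classical in
/-- The matrix of `U_g` on the representation with multiplicities `A`: block diagonal with the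
block `U^{(n/2)}(g)` for every `n` and every `α : A n`. -/
def rep (A : ℕ → Type*) (g : SU2) : Matrix (SpinIndex A) (SpinIndex A) ℂ :=
  Matrix.blockDiagonal' fun x : Σ n, A n => spinMatrix x.1 g

/-- A pure state `∑ ψ_{j,m,α} |j, m, α⟩`: a square-summable family of amplitudes, of norm one. -/
structure PureState (A : ℕ → Type*) where
  amp : SpinIndex A → ℂ
  normalized : HasSum (fun i => ‖amp i‖ ^ 2) 1

/-- The characteristic function `χ_ψ(g) = ⟨ψ| U_g |ψ⟩`. The inner sum has finitely many nonzero
terms, and the outer one converges absolutely since `U_g` is unitary. -/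
def charFun {A : ℕ → Type*} (ψ : PureState A) (g : SU2) : ℂ :=
  ∑' i, conj (ψ.amp i) * ∑' i', rep A g i i' * ψ.amp i'

/-- The weight `tr (Π_j |ψ⟩⟨ψ| Π_j)` of the total spin `j = n / 2` in the state `ψ`. -/
def spinWeight {A : ℕ → Type*} (ψ : PureState A) (n : ℕ) : ℝ :=
  ∑' i, if i.1.1 = n then ‖ψ.amp i‖ ^ 2 else 0

/-- The set of occupied total spins `j`, those with `tr (Π_j |ψ⟩⟨ψ| Π_j) > 0`. -/
def occupiedSpins {A : ℕ → Type*} (ψ : PureState A) : Set ℝ :=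
  {j | ∃ n : ℕ, j = (n : ℝ) / 2 ∧ 0 < spinWeight ψ n}

/-- The maximal occupied total spin. It is the maximum of the (nonempty, half-integer) set of
occupied spins whenever that set is bounded above. -/
def jmax {A : ℕ → Type*} (ψ : PureState A) : ℝ := sSup (occupiedSpins ψ)

/-- The matrix `|ψ⟩⟨ψ|`. -/
def densityMatrix {A : ℕ → Type*} (ψ : PureState A) :
    Matrix (SpinIndex A) (SpinIndex A) ℂ :=
  Matrix.of fun i i' => ψ.amp i * conj (ψ.amp i')

/-- The map `id_k ⊗ E` on matrices with entries indexed by `Fin k × I`. -/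
def ampliation {I I' : Type*} (E : Matrix I I ℂ →ₗ[ℂ] Matrix I' I' ℂ) (k : ℕ)
    (M : Matrix (Fin k × I) (Fin k × I) ℂ) : Matrix (Fin k × I') (Fin k × I') ℂ :=
  Matrix.of fun r s => E (Matrix.of fun i i' => M (r.1, i) (s.1, i')) r.2 s.2

/-- Complete positivity: every `id_k ⊗ E` preserves positive semidefiniteness. -/
def IsCompletelyPositive {I I' : Type*} [Fintype I] [Fintype I']
    (E : Matrix I I ℂ →ₗ[ℂ] Matrix I' I' ℂ) : Prop :=
  ∀ (k : ℕ) (M : Matrix (Fin k × I) (Fin k × I) ℂ),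
    M.PosSemidef → (ampliation E k M).PosSemidef

/-- `E` is a quantum operation (completely positive, trace non-increasing) from the
representation with multiplicities `A` to the one with multiplicities `B`, and it is
`SU(2)`-covariant: `E (U_g ρ U_g†) = U_g E(ρ) U_g†`. -/
structure IsCovariantOperation {A B : ℕ → Type*} [Fintype (SpinIndex A)]
    [Fintype (SpinIndex B)]
    (E : Matrix (SpinIndex A) (SpinIndex A) ℂ →ₗ[ℂ] Matrix (SpinIndex B) (SpinIndex B) ℂ) :
    Prop where
  completelyPositive : IsCompletelyPositive E
  trace_le : ∀ ρ : Matrix (SpinIndex A) (SpinIndex A) ℂ, ρ.PosSemidef →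
    (E ρ).trace.re ≤ ρ.trace.re
  covariant : ∀ (g : SU2) (ρ : Matrix (SpinIndex A) (SpinIndex A) ℂ),
    E (rep A g * ρ * (rep A g).conjTranspose) = rep B g * E ρ * (rep B g).conjTranspose

/-- `ψ` can be transformed to `φ` with probability `p` by an `SU(2)`-covariant quantum operation,
`E(|ψ⟩⟨ψ|) = p |φ⟩⟨φ|`. -/
def CovariantlyConvertible {A B : ℕ → Type*} [Fintype (SpinIndex A)] [Fintype (SpinIndex B)]
    (ψ : PureState A) (φ : PureState B) (p : ℝ) : Prop :=
  ∃ E : Matrix (SpinIndex A) (SpinIndex A) ℂ →ₗ[ℂ] Matrix (SpinIndex B) (SpinIndex B) ℂ,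
    IsCovariantOperation E ∧ E (densityMatrix ψ) = (p : ℂ) • densityMatrix φ

end SpinCovariance

end

noncomputable section

namespace SpinCovariance

/-! For fixed `g`, restrict `χ_ψ` to the conjugated torus `g⁻¹ diag(z, z⁻¹) g`. It becomes a Fourier
series in `z` whose coefficient at frequency `2m` is the total weight of `U_g ψ` on the vectors of
magnetic number `m` (`charFun_conj_torus`). All coefficients are nonnegative, so neither products
nor nonnegative combinations of such series can cancel. If the series of `ψ` stops at `N = 2
j_max(ψ)`, then so do those of `χ_ξ χ_φ` and of `χ_σ` (`eq_zero_of_fourier_eq`).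

It remains to see that every occupied spin shows up at its top frequency for some `g`. Along a
one-parameter family of rotations the highest-weight amplitude of an irreducible block is, up to a
nonzero factor, a polynomial whose coefficients are nonzero multiples of the amplitudes in that
block. A common non-root of two such polynomials gives a single `g` serving two states
(`exists_rotate_top_ne_zero`). Frequencies add in products, whence `2 j_ξ + 2 j_φ ≤ N` for occupied
spins.

For covariant operations, decompose matrices into modes under conjugation by the torus. A covariant
linear map preserves each mode. Every rotation of `|ψ⟩⟨ψ|` only has modes of modulus at most `2N`,
while a suitable rotation of `|φ⟩⟨φ|` has a nonzero entry between the highest and lowest weights of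
an occupied spin `n/2`, which lies in mode `2n`. Hence `n ≤ N`. -/

/-! ### Entries of elements of SU(2) -/

/-- Unitarity and determinant one force the adjoint to be the adjugate; this is one off-diagonal
entry of that identity. -/
theorem SU2.apply_zero_one (g : SU2) : g.1 0 1 = -conj (g.1 1 0) := by
  have hg := (Matrix.mem_specialUnitaryGroup_iff.1 g.2)
  have h1 : star g.1 * g.1 = 1 := Matrix.mem_unitaryGroup_iff'.1 hg.1
  have h2 : star g.1 = g.1.adjugate := by
    have := congrArg (· * g.1.adjugate) h1
    simpa [Matrix.mul_assoc, Matrix.mul_adjugate, hg.2] using this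
  have h3 := congrFun (congrFun h2 0) 1
  simp [Matrix.adjugate_fin_two, Matrix.star_apply] at h3
  simp [h3]

theorem SU2.apply_one_one (g : SU2) : g.1 1 1 = conj (g.1 0 0) := by
  have hg := (Matrix.mem_specialUnitaryGroup_iff.1 g.2)
  have h1 : star g.1 * g.1 = 1 := Matrix.mem_unitaryGroup_iff'.1 hg.1
  have h2 : star g.1 = g.1.adjugate := by
    have := congrArg (· * g.1.adjugate) h1
    simpa [Matrix.mul_assoc, Matrix.mul_adjugate, hg.2] using this
  have h3 := congrFun (congrFun h2 0) 0
  simp [Matrix.adjugate_fin_two, Matrix.star_apply] at h3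
  simp [h3]

theorem SU2.mul_apply_zero_zero (g h : SU2) :
    (g * h).1 0 0 = g.1 0 0 * h.1 0 0 - conj (g.1 1 0) * h.1 1 0 := by
  rw [Submonoid.coe_mul, Matrix.mul_apply, Fin.sum_univ_two, SU2.apply_zero_one]; ring

theorem SU2.mul_apply_one_zero (g h : SU2) :
    (g * h).1 1 0 = g.1 1 0 * h.1 0 0 + conj (g.1 0 0) * h.1 1 0 := by
  rw [Submonoid.coe_mul, Matrix.mul_apply, Fin.sum_univ_two, SU2.apply_one_one]

theorem SU2.inv_apply_zero_zero (g : SU2) : (g⁻¹).1 0 0 = conj (g.1 0 0) := rfl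

theorem SU2.inv_apply_one_zero (g : SU2) : (g⁻¹).1 1 0 = -g.1 1 0 := by
  have : (g⁻¹).1 1 0 = conj (g.1 0 1) := rfl
  rw [this, SU2.apply_zero_one]; simp

/-! ### Spin matrices as symmetric powers: multiplicativity and unitarity -/

/-- The coefficient of `p ^ (n - k') * q ^ k'` in `(a p + c q) ^ (n - k) * (b p + d q) ^ k`. -/
def symCoeff {R : Type*} [CommRing R] (n : ℕ) (a b c d : R) (k' k : ℕ) : R :=
  ∑ i ∈ Finset.Icc (k - k') (min k (n - k')),
    (k.choose i : R) * ((n - k).choose (k' + i - k) : R) * b ^ i *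
      a ^ (n - k' - i) * d ^ (k - i) * c ^ (k' + i - k)

theorem sum_symCoeff_mul {R : Type*} [CommRing R] {n k : ℕ} (hk : k ≤ n) (a b c d p q : R) :
    ∑ k' ∈ Finset.range (n + 1), symCoeff n a b c d k' k * (p ^ (n - k') * q ^ k') =
      (a * p + c * q) ^ (n - k) * (b * p + d * q) ^ k := by
  rw [add_comm (a * p), add_pow, add_pow, Finset.sum_mul_sum]
  simp only [symCoeff, Finset.sum_mul]
  rw [Finset.sum_sigma', Finset.sum_sigma']
  -- With `i` factors `b p` and `j` factors `c q` chosen, the exponent of `q` is `j + (k - i) = k'`,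
  -- so `j = k' + i - k`.
  refine Finset.sum_nbij' (fun x => ⟨x.1 + x.2 - k, x.2⟩) (fun y => ⟨y.1 + k - y.2, y.2⟩)
    ?_ ?_ ?_ ?_ ?_
  · rintro ⟨x, i⟩ h
    simp only [Finset.mem_sigma, Finset.mem_range, Finset.mem_Icc, le_min_iff] at h ⊢
    omega
  · rintro ⟨x, i⟩ h
    simp only [Finset.mem_sigma, Finset.mem_range, Finset.mem_Icc, le_min_iff] at h ⊢
    omega
  · rintro ⟨x, i⟩ h
    simp only [Finset.mem_sigma, Finset.mem_range, Finset.mem_Icc, le_min_iff] at h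
    simp only [Sigma.mk.injEq, heq_eq_eq, and_true]
    omega
  · rintro ⟨x, i⟩ h
    simp only [Finset.mem_sigma, Finset.mem_range] at h
    simp only [Sigma.mk.injEq, heq_eq_eq, and_true]
    omega
  · rintro ⟨x, i⟩ h
    simp only [Finset.mem_sigma, Finset.mem_range, Finset.mem_Icc, le_min_iff] at h
    -- The numbers `f, i, j, e` are the exponents of `a, b, c, d`; they replace all truncated
    -- subtractions.
    obtain ⟨j, hj⟩ : ∃ j, x + i = k + j := ⟨x + i - k, by omega⟩
    obtain ⟨e, he⟩ : ∃ e, k = i + e := ⟨k - i, by omega⟩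
    obtain ⟨f, hf⟩ : ∃ f, n = k + j + f := ⟨n - k - j, by omega⟩
    have e1 : x + i - k = j := by omega
    have e2 : i + f - i = f := by omega
    have e3 : k - i = e := by omega
    have e4 : n - x = i + f := by omega
    have e5 : x = e + j := by omega
    have e6 : n - k - j = f := by omega
    simp only [e1, e3, e4, e2, e6, mul_pow]
    rw [e5]
    ring

theorem spinMatrix_apply (n : ℕ) (g : SU2) (k' k : Fin (n + 1)) :
    spinMatrix n g k' k = (Real.sqrt (n.choose k) / Real.sqrt (n.choose k') : ℂ) *
      symCoeff n (g.1 0 0) (-conj (g.1 1 0)) (g.1 1 0) (conj (g.1 0 0)) k' k := by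
  simp only [spinMatrix, Matrix.of_apply, symCoeff]
  rw [Real.sqrt_div (by positivity)]
  push_cast
  congr 1
  refine Finset.sum_congr rfl fun i _ => ?_
  rw [neg_pow (conj (g.1 1 0))]
  ring

theorem sqrt_choose_ne_zero {n : ℕ} (k : Fin (n + 1)) : (Real.sqrt (n.choose k) : ℂ) ≠ 0 := by
  have : 0 < n.choose k := Nat.choose_pos (Nat.lt_succ_iff.1 k.2)
  norm_cast
  exact Real.sqrt_ne_zero'.2 (by exact_mod_cast this)

/-- Linear substitutions in two variables compose by the matrix product, and `symCoeff` is the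
matrix of such a substitution on forms of degree `n`. -/
theorem symCoeff_mul {n : ℕ} (a b c d a' b' c' d' : ℂ) (k' k : Fin (n + 1)) :
    symCoeff n (a * a' + b * c') (a * b' + b * d') (c * a' + d * c') (c * b' + d * d') k' k =
      ∑ l : Fin (n + 1), symCoeff n a b c d k' l * symCoeff n a' b' c' d' l k := by
  -- Forms are dehomogenised at `p = 1`, `q = X`, so that coefficients can be compared in one
  -- variable.
  open Polynomial in
  have key : ∑ j ∈ Finset.range (n + 1),
      C (symCoeff n (a * a' + b * c') (a * b' + b * d') (c * a' + d * c') (c * b' + d * d') j k)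
        * X ^ j =
      ∑ j ∈ Finset.range (n + 1),
        C (∑ l : Fin (n + 1), symCoeff n a b c d j l * symCoeff n a' b' c' d' l k) * X ^ j := by
    have cast (a b c d : ℂ) (i j : ℕ) :
        C (symCoeff n a b c d i j) = symCoeff n (C a) (C b) (C c) (C d) i j := by
      simp [symCoeff]
    have hk : (k : ℕ) ≤ n := Nat.lt_succ_iff.1 k.2
    have h1 := sum_symCoeff_mul hk (C (a * a' + b * c')) (C (a * b' + b * d'))
      (C (c * a' + d * c')) (C (c * b' + d * d')) 1 X
    have h2 := sum_symCoeff_mul hk (C a') (C b') (C c') (C d')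
      (C a * 1 + C c * X) (C b * 1 + C d * X)
    simp only [← cast, one_pow, one_mul] at h1
    rw [h1]
    simp only [map_sum, Finset.sum_mul]
    rw [Finset.sum_comm]
    have h3 (l : Fin (n + 1)) : ∑ j ∈ Finset.range (n + 1),
        C (symCoeff n a b c d j l * symCoeff n a' b' c' d' l k) * X ^ j =
        C (symCoeff n a' b' c' d' l k) * ((C a * 1 + C c * X) ^ (n - (l : ℕ)) *
          (C b * 1 + C d * X) ^ (l : ℕ)) := by
      rw [← sum_symCoeff_mul (Nat.lt_succ_iff.1 l.2), Finset.mul_sum]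
      refine Finset.sum_congr rfl fun j _ => ?_
      rw [← cast, C_mul]; ring
    rw [Finset.sum_congr rfl fun l _ => h3 l,
      Fin.sum_univ_eq_sum_range (fun l => C (symCoeff n a' b' c' d' l k) *
        ((C a * 1 + C c * X) ^ (n - l) * (C b * 1 + C d * X) ^ l)) (n + 1)]
    simp only [cast]
    rw [h2]
    simp only [C_add, C_mul]
    congr 2 <;> ring
  have := congrArg (fun P => Polynomial.coeff P k') key
  simpa only [Polynomial.finsetSum_coeff, Polynomial.coeff_C_mul, Polynomial.coeff_X_pow,
    mul_ite, mul_one, mul_zero, Finset.sum_ite_eq, Finset.mem_range, k'.2, if_true] using this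

theorem spinMatrix_mul (n : ℕ) (g h : SU2) :
    spinMatrix n (g * h) = spinMatrix n g * spinMatrix n h := by
  ext k' k
  rw [Matrix.mul_apply]
  simp only [spinMatrix_apply, SU2.mul_apply_zero_zero, SU2.mul_apply_one_zero]
  have := symCoeff_mul (g.1 0 0) (-conj (g.1 1 0)) (g.1 1 0) (conj (g.1 0 0))
    (h.1 0 0) (-conj (h.1 1 0)) (h.1 1 0) (conj (h.1 0 0)) k' k
  have e1 : g.1 0 0 * h.1 0 0 - conj (g.1 1 0) * h.1 1 0 =
    g.1 0 0 * h.1 0 0 + -conj (g.1 1 0) * h.1 1 0 := by ring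
  have e2 : -conj (g.1 1 0 * h.1 0 0 + conj (g.1 0 0) * h.1 1 0) =
    g.1 0 0 * -conj (h.1 1 0) + -conj (g.1 1 0) * conj (h.1 0 0) := by
    simp only [map_add, map_mul, Complex.conj_conj]; ring
  have e3 : conj (g.1 0 0 * h.1 0 0 - conj (g.1 1 0) * h.1 1 0) =
    g.1 1 0 * -conj (h.1 1 0) + conj (g.1 0 0) * conj (h.1 0 0) := by
    simp only [map_sub, map_mul, Complex.conj_conj]; ring
  rw [e2, e3, e1, this, Finset.mul_sum]
  refine Finset.sum_congr rfl fun l _ => ?_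
  have := sqrt_choose_ne_zero l
  field_simp

/-- Both sides have the multinomial coefficient `n! / (f! i! j! e!)` at `a^f b^i c^j d^e`. The
binomial weights thus turn transposition of the 2×2 matrix into transposition on the symmetric
power, and the square roots in `spinMatrix` convert this into unitarity. -/
theorem choose_mul_symCoeff {R : Type*} [CommRing R] {n k k' : ℕ} (hk : k ≤ n) (hk' : k' ≤ n)
    (a b c d : R) :
    (n.choose k : R) * symCoeff n a b c d k' k = n.choose k' * symCoeff n a c b d k k' := by
  rw [symCoeff, symCoeff, Finset.mul_sum, Finset.mul_sum]
  refine Finset.sum_nbij' (fun i => k' + i - k) (fun i => k + i - k') ?_ ?_ ?_ ?_ ?_ <;>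
    intro i h <;> simp only [Finset.mem_Icc, le_min_iff] at h ⊢
  · omega
  · omega
  · omega
  · omega
  · obtain ⟨j, hj⟩ : ∃ j, k' + i = k + j := ⟨k' + i - k, by omega⟩
    obtain ⟨e, he⟩ : ∃ e, k = i + e := ⟨k - i, by omega⟩
    obtain ⟨f, hf⟩ : ∃ f, n = k + j + f := ⟨n - k - j, by omega⟩
    obtain rfl : k' = j + e := by omega
    subst he
    have e1 : j + e + i - (i + e) = j := by omega
    have e2 : n - (i + e) = j + f := by omega
    have e3 : n - (j + e) = i + f := by omega
    have e4 : i + e + j - (j + e) = i := by omega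
    have e5 : i + f - i = f := by omega
    have e6 : j + f - j = f := by omega
    have e7 : i + e - i = e := by omega
    have e8 : j + e - j = e := by omega
    simp only [e1, e2, e3, e4, e5, e6, e7, e8]
    have hc : n.choose (i + e) * ((i + e).choose i * (j + f).choose j) =
        n.choose (j + e) * ((j + e).choose j * (i + f).choose i) := by
      have choose_fac (x y : ℕ) : (x + y).choose x * x.factorial * y.factorial =
          (x + y).factorial := by
        rw [Nat.choose_symm_add, Nat.add_choose_mul_factorial_mul_factorial]
      have h1 := choose_fac (i + e) (j + f)
      have h2 := choose_fac (j + e) (i + f)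
      have h3 := choose_fac i e
      have h4 := choose_fac j f
      have h5 := choose_fac j e
      have h6 := choose_fac i f
      have n1 : i + e + (j + f) = n := by omega
      have n2 : j + e + (i + f) = n := by omega
      rw [n1] at h1
      rw [n2] at h2
      have hpos : 0 < i.factorial * e.factorial * j.factorial * f.factorial := by positivity
      refine Nat.eq_of_mul_eq_mul_right hpos ?_
      calc _ = n.choose (i + e) * ((i + e).choose i * i.factorial * e.factorial) *
            ((j + f).choose j * j.factorial * f.factorial) := by ring
        _ = n.choose (j + e) * ((j + e).choose j * j.factorial * e.factorial) *
            ((i + f).choose i * i.factorial * f.factorial) := by rw [h3, h4, h5, h6, h1, h2]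
        _ = _ := by ring
    have hc' : (n.choose (i + e) : R) * ((i + e).choose i * (j + f).choose j) =
        n.choose (j + e) * ((j + e).choose j * (i + f).choose i) := by
      simpa only [Nat.cast_mul] using congrArg (Nat.cast (R := R)) hc
    linear_combination (b ^ i * a ^ f * d ^ e * c ^ j) * hc'

theorem spinMatrix_inv (n : ℕ) (g : SU2) :
    spinMatrix n g⁻¹ = (spinMatrix n g).conjTranspose := by
  ext k' k
  rw [Matrix.conjTranspose_apply]
  simp only [spinMatrix_apply, SU2.inv_apply_zero_zero, SU2.inv_apply_one_zero]
  have h := choose_mul_symCoeff (Nat.lt_succ_iff.1 k.2) (Nat.lt_succ_iff.1 k'.2)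
    (conj (g.1 0 0)) (conj (g.1 1 0)) (-g.1 1 0) (g.1 0 0)
  have hs (k : Fin (n + 1)) : (n.choose k : ℂ) = (Real.sqrt (n.choose k) : ℂ) ^ 2 := by
    norm_cast
    rw [Real.sq_sqrt (by positivity)]
  have hstar (i j : ℕ) (a b c d : ℂ) :
      star (symCoeff n a b c d i j) = symCoeff n (star a) (star b) (star c) (star d) i j := by
    simp [symCoeff]
  rw [star_mul', hstar]
  rw [hs, hs] at h
  have h1 := sqrt_choose_ne_zero k
  have h2 := sqrt_choose_ne_zero k'
  simp only [map_neg, neg_neg, Complex.conj_conj, star_neg, RCLike.star_def, map_div₀,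
    Complex.conj_ofReal]
  field_simp
  exact h

/-! ### The torus, the action on amplitudes, and characteristic functions -/

/-- The diagonal element `diag(z, z⁻¹)` of `SU(2)`. -/
def torus (z : Circle) : SU2 :=
  ⟨!![(z : ℂ), 0; 0, conj (z : ℂ)], by
    have hz : (z : ℂ) * conj (z : ℂ) = 1 := by
      rw [Complex.mul_conj, Complex.normSq_eq_norm_sq, Circle.norm_coe]; simp
    rw [Matrix.mem_specialUnitaryGroup_iff, Matrix.mem_unitaryGroup_iff]
    refine ⟨?_, by rw [Matrix.det_fin_two_of]; simpa using hz⟩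
    ext i j
    fin_cases i <;> fin_cases j <;>
      simp [Matrix.mul_apply, Fin.sum_univ_two, Matrix.star_apply, hz, mul_comm (conj (z : ℂ))]⟩

/-- Each monomial has `n - k'` factors from the first row of `g` and `k'` from the second; the torus
scales these rows by `z` and `z⁻¹`. -/
theorem spinMatrix_torus_mul (n : ℕ) (z : Circle) (g : SU2) (k' k : Fin (n + 1)) :
    spinMatrix n (torus z * g) k' k =
      (z : ℂ) ^ ((n : ℤ) - 2 * (k' : ℤ)) * spinMatrix n g k' k := by
  have hk' : (k' : ℕ) ≤ n := Nat.lt_succ_iff.1 k'.2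
  have hu : (torus z * g).1 0 0 = z * g.1 0 0 := by
    rw [SU2.mul_apply_zero_zero]; simp [torus]
  have hv : (torus z * g).1 1 0 = conj (z : ℂ) * g.1 1 0 := by
    rw [SU2.mul_apply_one_zero]; simp [torus]
  have hpow : (z : ℂ) ^ ((n : ℤ) - 2 * (k' : ℤ)) =
      (z : ℂ) ^ (n - (k' : ℕ)) * conj (z : ℂ) ^ (k' : ℕ) := by
    rw [← Circle.coe_inv_eq_conj, Circle.coe_inv, inv_pow, ← zpow_natCast, ← zpow_natCast,
      ← zpow_neg, ← zpow_add₀ (Circle.coe_ne_zero z)]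
    congr 1
    omega
  rw [spinMatrix_apply, spinMatrix_apply, hu, hv, mul_left_comm]
  congr 1
  rw [symCoeff, symCoeff, Finset.mul_sum]
  refine Finset.sum_congr rfl fun i hi => ?_
  simp only [Finset.mem_Icc, le_min_iff] at hi
  have h1 : n - (k' : ℕ) = i + (n - (k' : ℕ) - i) := by omega
  have h2 : (k' : ℕ) = (k - i) + (k' + i - k) := by omega
  rw [hpow]
  have e1 : (z : ℂ) ^ (n - (k' : ℕ)) = z ^ i * z ^ (n - (k' : ℕ) - i) := by
    rw [← pow_add, ← h1]
  have e2 : conj (z : ℂ) ^ (k' : ℕ) =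
      conj (z : ℂ) ^ ((k : ℕ) - i) * conj (z : ℂ) ^ ((k' : ℕ) + i - k) := by
    rw [← pow_add, ← h2]
  rw [e1, e2]
  simp only [map_mul, Complex.conj_conj, ← mul_neg, mul_pow]
  ring

variable {A B C D : ℕ → Type*}

/-- The vector `U_g f`. -/
def rotate (g : SU2) (f : SpinIndex A → ℂ) (i : SpinIndex A) : ℂ :=
  ∑ k, spinMatrix i.1.1 g i.2 k * f ⟨i.1, k⟩

/-- The weight `2m` of the basis vector `|j, m, α⟩`. -/
def weight (i : SpinIndex A) : ℤ := (i.1.1 : ℤ) - 2 * ((i.2 : ℕ) : ℤ)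

theorem abs_weight_le (i : SpinIndex A) : |weight i| ≤ i.1.1 := by
  have := i.2.2
  rw [weight, abs_le]
  omega

theorem tsum_rep_mul (g : SU2) (f : SpinIndex A → ℂ) (i : SpinIndex A) :
    ∑' i', rep A g i i' * f i' = rotate g f i := by
  classical
  obtain ⟨x, k⟩ := i
  rw [tsum_eq_sum (s := Finset.univ.map ⟨Sigma.mk x, sigma_mk_injective⟩), Finset.sum_map]
  · simp [rotate, rep]
  · rintro ⟨y, l⟩ h
    have hxy : x ≠ y := by
      rintro rfl
      simp at h
    rw [rep, Matrix.blockDiagonal'_apply_ne _ _ _ hxy, zero_mul]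

theorem rotate_torus_mul (z : Circle) (g : SU2) (f : SpinIndex A → ℂ) (i : SpinIndex A) :
    rotate (torus z * g) f i = (z : ℂ) ^ weight i * rotate g f i := by
  simp only [rotate, spinMatrix_torus_mul, Finset.mul_sum, mul_assoc, weight]

theorem rotate_mul (g h : SU2) (f : SpinIndex A → ℂ) (x : Σ n, A n) :
    (fun k => rotate (g * h) f ⟨x, k⟩) =
      (spinMatrix x.1 g).mulVec (fun k => rotate h f ⟨x, k⟩) := by
  have (g : SU2) : (fun k => rotate g f ⟨x, k⟩) =
      (spinMatrix x.1 g).mulVec (fun k => f ⟨x, k⟩) := rfl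
  rw [this, this, spinMatrix_mul, Matrix.mulVec_mulVec]

theorem sum_conj_mul_rotate_inv_mul (g h : SU2) (f : SpinIndex A → ℂ) (x : Σ n, A n) :
    ∑ k, conj (f ⟨x, k⟩) * rotate (g⁻¹ * h) f ⟨x, k⟩ =
      ∑ k, conj (rotate g f ⟨x, k⟩) * rotate h f ⟨x, k⟩ := by
  have h1 := congrArg (fun v => star (fun k => f ⟨x, k⟩) ⬝ᵥ v) (rotate_mul g⁻¹ h f x)
  rw [spinMatrix_inv, Matrix.dotProduct_mulVec, ← Matrix.star_mulVec] at h1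
  exact h1

theorem spinMatrix_one (n : ℕ) : spinMatrix n 1 = 1 := by
  ext k' k
  have hsym : symCoeff n (1 : ℂ) 0 0 1 k' k = if k' = k then 1 else 0 := by
    have hk : (k : ℕ) ≤ n := Nat.lt_succ_iff.1 k.2
    split_ifs with h
    · subst h
      rw [symCoeff, Finset.sum_eq_single 0]
      · simp
      · intro i _ hi
        simp [hi]
      · simp
    · refine Finset.sum_eq_zero fun i hi => ?_
      simp only [Finset.mem_Icc] at hi
      have hne : (k' : ℕ) ≠ k := fun e => h (Fin.ext e)
      rcases Nat.eq_zero_or_pos i with rfl | hi0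
      · have : (k' : ℕ) + 0 - k ≠ 0 := by omega
        simp only [zero_pow this, mul_zero]
      · simp only [zero_pow hi0.ne', mul_zero, zero_mul]
  have h0 : (1 : SU2).1 0 0 = 1 := rfl
  have h1 : (1 : SU2).1 1 0 = 0 := rfl
  rw [spinMatrix_apply, h0, h1, map_zero, neg_zero, map_one, hsym, Matrix.one_apply]
  split_ifs with h
  · rw [h, mul_one, div_self (sqrt_choose_ne_zero k)]
  · rw [mul_zero]

theorem rotate_one (f : SpinIndex A → ℂ) : rotate 1 f = f := by
  funext ⟨x, k⟩
  simp [rotate, spinMatrix_one, Matrix.one_apply]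

theorem sum_norm_rotate_sq (g : SU2) (f : SpinIndex A → ℂ) (x : Σ n, A n) :
    ∑ k, ‖rotate g f ⟨x, k⟩‖ ^ 2 = ∑ k, ‖f ⟨x, k⟩‖ ^ 2 := by
  have h := sum_conj_mul_rotate_inv_mul g g f x
  rw [inv_mul_cancel, rotate_one] at h
  simp only [mul_comm (conj _), Complex.mul_conj, Complex.normSq_eq_norm_sq] at h
  exact_mod_cast h.symm

theorem summable_norm_rotate_sq (ψ : PureState A) (g : SU2) :
    Summable fun i => ‖rotate g ψ.amp i‖ ^ 2 := by
  rw [summable_sigma_of_nonneg fun _ => by positivity]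
  refine ⟨fun x => (hasSum_fintype _).summable, ?_⟩
  have h := ((summable_sigma_of_nonneg fun _ => by positivity).1 ψ.normalized.summable).2
  simpa only [tsum_fintype, sum_norm_rotate_sq] using h

theorem summable_charFun (ψ : PureState A) (g h : SU2) :
    Summable fun i => conj (rotate g ψ.amp i) * rotate h ψ.amp i := by
  refine Summable.of_norm_bounded
    ((summable_norm_rotate_sq ψ g).add (summable_norm_rotate_sq ψ h)) fun i => ?_
  rw [norm_mul, RCLike.norm_conj]
  nlinarith [sq_nonneg (‖rotate g ψ.amp i‖ - ‖rotate h ψ.amp i‖),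
    sq_nonneg ‖rotate g ψ.amp i‖, sq_nonneg ‖rotate h ψ.amp i‖]

/-- This is `⟨U_g ψ, U_h ψ⟩`, by unitarity on each irreducible block. -/
theorem charFun_inv_mul (ψ : PureState A) (g h : SU2) :
    charFun ψ (g⁻¹ * h) = ∑' i, conj (rotate g ψ.amp i) * rotate h ψ.amp i := by
  have h1 := summable_charFun ψ 1 (g⁻¹ * h)
  rw [rotate_one] at h1
  simp only [charFun, tsum_rep_mul]
  rw [h1.tsum_sigma, (summable_charFun ψ g h).tsum_sigma]
  simp only [tsum_fintype, sum_conj_mul_rotate_inv_mul]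

theorem charFun_conj_torus (ψ : PureState A) (g : SU2) (z : Circle) :
    charFun ψ (g⁻¹ * (torus z * g)) =
      ∑' i, (z : ℂ) ^ weight i * (‖rotate g ψ.amp i‖ ^ 2 : ℝ) := by
  rw [charFun_inv_mul]
  refine tsum_congr fun i => ?_
  rw [rotate_torus_mul, mul_left_comm, mul_comm (conj _), Complex.mul_conj,
    Complex.normSq_eq_norm_sq]

/-! ### Fourier series on the circle with nonnegative coefficients -/

theorem exists_circle_sum_zpow (M : ℕ) (hM : M ≠ 0) :
    ∃ ζ : Circle, ∀ d : ℤ, ∑ s ∈ Finset.range M, ((ζ ^ s : Circle) : ℂ) ^ d =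
      if (M : ℤ) ∣ d then (M : ℂ) else 0 := by
  have hprim := Complex.isPrimitiveRoot_exp M hM
  set ω := Complex.exp (2 * Real.pi * Complex.I / M)
  obtain ⟨ζ, hζ⟩ : ∃ ζ : Circle, (ζ : ℂ) = ω :=
    ⟨⟨ω, mem_sphere_zero_iff_norm.2 (hprim.norm'_eq_one hM)⟩, rfl⟩
  refine ⟨ζ, fun d => ?_⟩
  have hs (s : ℕ) : ((ζ ^ s : Circle) : ℂ) ^ d = (ω ^ d) ^ s := by
    rw [Circle.coe_pow, hζ, ← zpow_natCast, ← zpow_natCast, ← zpow_mul, ← zpow_mul, mul_comm]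
  simp only [hs]
  split_ifs with h
  · rw [(hprim.zpow_eq_one_iff_dvd d).2 h]; simp
  · have hne : ω ^ d ≠ 1 := fun e => h ((hprim.zpow_eq_one_iff_dvd d).1 e)
    have h1 := mul_geom_sum (ω ^ d) M
    rw [← zpow_natCast, ← zpow_mul, mul_comm d, zpow_mul, zpow_natCast, hprim.pow_eq_one,
      one_zpow, sub_self] at h1
    exact (mul_eq_zero.1 h1).resolve_left (sub_ne_zero.2 hne)

theorem summable_zpow_mul {I : Type*} {q : I → ℝ} (hq : Summable q) (w : I → ℤ) (z : Circle) :
    Summable fun i => (z : ℂ) ^ w i * (q i : ℂ) := by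
  refine Summable.of_norm_bounded hq.norm fun i => ?_
  rw [norm_mul, norm_zpow, Circle.norm_coe, one_zpow, one_mul, Complex.norm_real]

/-- Sampling at the `M`-th roots of unity extracts the frequencies congruent to `l` modulo `M`.
Aliasing is harmless: nonnegativity lets no other frequency hide a contribution at `l`. -/
theorem sum_zpow_neg_mul_tsum {I : Type*} {q : I → ℝ} (hq : Summable q) (w : I → ℤ) {M : ℕ}
    {ζ : Circle} (hζ : ∀ d : ℤ, ∑ s ∈ Finset.range M, ((ζ ^ s : Circle) : ℂ) ^ d =
      if (M : ℤ) ∣ d then (M : ℂ) else 0) (l : ℤ) :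
    ∑ s ∈ Finset.range M, ((ζ ^ s : Circle) : ℂ) ^ (-l) *
        ∑' i, ((ζ ^ s : Circle) : ℂ) ^ w i * (q i : ℂ) =
      ((∑' i, if (M : ℤ) ∣ w i - l then M * q i else 0 : ℝ) : ℂ) := by
  simp only [← tsum_mul_left]
  rw [← Summable.tsum_finsetSum fun s _ => (summable_zpow_mul hq w _).mul_left _,
    Complex.ofReal_tsum]
  refine tsum_congr fun i => ?_
  have h := hζ (w i - l)
  simp only [← mul_assoc, ← zpow_add₀ (Circle.coe_ne_zero _)]
  rw [← Finset.sum_mul]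
  simp only [neg_add_eq_sub, h]
  split_ifs <;> simp

theorem ite_dvd_nonneg {I : Type*} {q : I → ℝ} (hq : ∀ i, 0 ≤ q i) (w : I → ℤ) (M : ℕ) (l : ℤ)
    (i : I) : 0 ≤ if (M : ℤ) ∣ w i - l then M * q i else 0 := by
  have := hq i
  split_ifs <;> positivity

theorem mul_eq_zero_of_mul_tsum_ite_dvd {I : Type*} {q : I → ℝ} (hq : Summable q)
    (hq0 : ∀ i, 0 ≤ q i) {w : I → ℤ} {M : ℕ} (hM : M ≠ 0) {l : ℤ} {c : ℝ}
    (h : c * (∑' i, if (M : ℤ) ∣ w i - l then M * q i else 0) = 0) (i : I) (hi : w i = l) :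
    c * q i = 0 := by
  have hsum : Summable fun i => if (M : ℤ) ∣ w i - l then M * q i else 0 := by
    refine Summable.of_nonneg_of_le (ite_dvd_nonneg hq0 w M l) (fun i => ?_)
      (hq.mul_left (M : ℝ))
    have := hq0 i
    split_ifs
    · exact le_rfl
    · positivity
  rcases mul_eq_zero.1 h with h | h
  · rw [h, zero_mul]
  · have h' := congrFun
      ((hasSum_zero_iff_of_nonneg (ite_dvd_nonneg hq0 w M l)).1 (h ▸ hsum.hasSum)) i
    have hM0 : (M : ℝ) ≠ 0 := by exact_mod_cast hM
    simp only [hi, sub_self, dvd_zero, if_true, Pi.zero_apply, mul_eq_zero, hM0, false_or] at h'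
    rw [h', mul_zero]

/-- If a nonnegative family of Fourier coefficients with frequencies in `[-N, N]` is a nonnegative
combination of two others, then these have no frequencies above `N` either. -/
theorem eq_zero_of_fourier_eq {I J K : Type*} {q : I → ℝ} {q₁ : J → ℝ} {q₂ : K → ℝ}
    {w : I → ℤ} {w₁ : J → ℤ} {w₂ : K → ℤ} (hq : Summable q) (hq₁ : Summable q₁)
    (hq₂ : Summable q₂) (h₁ : ∀ j, 0 ≤ q₁ j) (h₂ : ∀ k, 0 ≤ q₂ k)
    {p r : ℝ} (hp : 0 ≤ p) (hr : 0 ≤ r)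
    (H : ∀ z : Circle, ∑' i, (z : ℂ) ^ w i * (q i : ℂ) =
      p * ∑' j, (z : ℂ) ^ w₁ j * (q₁ j : ℂ) + r * ∑' k, (z : ℂ) ^ w₂ k * (q₂ k : ℂ))
    {N : ℕ} (hN : ∀ i, q i ≠ 0 → |w i| ≤ N) :
    (∀ j, (N : ℤ) < w₁ j → p * q₁ j = 0) ∧ ∀ k, (N : ℤ) < w₂ k → r * q₂ k = 0 := by
  have key (l : ℕ) (hl : N < l) :
      (∀ j, w₁ j = l → p * q₁ j = 0) ∧ ∀ k, w₂ k = l → r * q₂ k = 0 := by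
    -- For `|w| ≤ N < l` the difference `w - l` lies strictly between `-M` and `0`, so no frequency
    -- of `q` is aliased to `l`.
    set M := l + N + 1 with hM
    obtain ⟨ζ, hζ⟩ := exists_circle_sum_zpow M (by omega)
    have h0 := sum_zpow_neg_mul_tsum hq w hζ l
    have e1 := sum_zpow_neg_mul_tsum hq₁ w₁ hζ l
    have e2 := sum_zpow_neg_mul_tsum hq₂ w₂ hζ l
    have hzero : (∑' i, if (M : ℤ) ∣ w i - l then M * q i else 0 : ℝ) = 0 := by
      refine (tsum_congr fun i => ?_).trans tsum_zero
      split_ifs with hd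
      · by_contra hne
        have hb := abs_le.1 (hN i (right_ne_zero_of_mul hne))
        obtain ⟨c, hc⟩ := hd
        have hneg : w i - l < 0 := by omega
        have hc0 : c < 0 := by
          by_contra hc0
          have : 0 ≤ (M : ℤ) * c := mul_nonneg (by omega) (by omega)
          omega
        have : (M : ℤ) * c ≤ (M : ℤ) * (-1) := mul_le_mul_of_nonneg_left (by omega) (by omega)
        omega
      · rfl
    have hcomb : p * (∑' j, if (M : ℤ) ∣ w₁ j - l then M * q₁ j else 0) +
        r * (∑' k, if (M : ℤ) ∣ w₂ k - l then M * q₂ k else 0) = 0 := by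
      simp only [H, mul_add, mul_left_comm _ (p : ℂ), mul_left_comm _ (r : ℂ),
        Finset.sum_add_distrib, ← Finset.mul_sum] at h0
      rw [e1, e2, hzero] at h0
      exact_mod_cast h0
    have t₁ := mul_nonneg hp (tsum_nonneg (ite_dvd_nonneg h₁ w₁ M l) (L := .unconditional _))
    have t₂ := mul_nonneg hr (tsum_nonneg (ite_dvd_nonneg h₂ w₂ M l) (L := .unconditional _))
    have hz := (add_eq_zero_iff_of_nonneg t₁ t₂).1 hcomb
    exact ⟨mul_eq_zero_of_mul_tsum_ite_dvd hq₁ h₁ (by omega) hz.1,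
      mul_eq_zero_of_mul_tsum_ite_dvd hq₂ h₂ (by omega) hz.2⟩
  refine ⟨fun j hj => ?_, fun k hk => ?_⟩
  · exact (key (w₁ j).toNat (by omega)).1 j (by omega)
  · exact (key (w₂ k).toNat (by omega)).2 k (by omega)

/-! ### Rotations that populate the extreme weights -/

/-- The rotation with `u = 1 / √(1 + x²)` and `v = -x / √(1 + x²)`. -/
def realRotation (x : ℝ) : SU2 :=
  ⟨!![((1 / √(1 + x ^ 2) : ℝ) : ℂ), ((x / √(1 + x ^ 2) : ℝ) : ℂ);
      -((x / √(1 + x ^ 2) : ℝ) : ℂ), ((1 / √(1 + x ^ 2) : ℝ) : ℂ)], by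
    have h0 : 0 < 1 + x ^ 2 := by positivity
    have hab : ((1 / √(1 + x ^ 2) : ℝ) : ℂ) ^ 2 + ((x / √(1 + x ^ 2) : ℝ) : ℂ) ^ 2 = 1 := by
      norm_cast
      rw [div_pow, div_pow, Real.sq_sqrt h0.le]
      field_simp
    generalize 1 / √(1 + x ^ 2) = a at hab ⊢
    generalize x / √(1 + x ^ 2) = b at hab ⊢
    rw [Matrix.mem_specialUnitaryGroup_iff, Matrix.mem_unitaryGroup_iff]
    constructor
    · ext i j
      fin_cases i <;> fin_cases j <;>
        simp [Matrix.mul_apply, Fin.sum_univ_two, Matrix.star_apply] <;>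
        first | linear_combination hab | linear_combination
    · rw [Matrix.det_fin_two_of]
      linear_combination hab⟩

theorem symCoeff_zero_left {R : Type*} [CommRing R] {n k : ℕ} (hk : k ≤ n) (a b c d : R) :
    symCoeff n a b c d 0 k = b ^ k * a ^ (n - k) := by
  simp [symCoeff, hk]

theorem symCoeff_self_left {R : Type*} [CommRing R] {n k : ℕ} (hk : k ≤ n) (a b c d : R) :
    symCoeff n a b c d n k = d ^ k * c ^ (n - k) := by
  simp [symCoeff, hk]

open Polynomial in
/-- Up to a nonzero factor, its values are the amplitudes of `realRotation x` applied to `f` at the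
highest weight. -/
def topPoly (f : SpinIndex A → ℂ) (x : Σ n, A n) : ℂ[X] :=
  ∑ k : Fin (x.1 + 1), Polynomial.C (Real.sqrt (x.1.choose k) * f ⟨x, k⟩) * X ^ (k : ℕ)

open Polynomial in
/-- Up to a nonzero factor, its values are the amplitudes of `realRotation x` applied to `f` at the
lowest weight. -/
def bottomPoly (f : SpinIndex A → ℂ) (x : Σ n, A n) : ℂ[X] :=
  ∑ k : Fin (x.1 + 1),
    Polynomial.C (Real.sqrt (x.1.choose k) * f ⟨x, k⟩ * (-1) ^ (x.1 - (k : ℕ))) *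
      X ^ (x.1 - (k : ℕ))

theorem topPoly_ne_zero {f : SpinIndex A → ℂ} {i : SpinIndex A} (h : f i ≠ 0) :
    topPoly f i.1 ≠ 0 := by
  obtain ⟨x, k⟩ := i
  intro h0
  have h1 := congrArg (fun P => P.coeff (k : ℕ)) h0
  simp only [topPoly, Polynomial.finsetSum_coeff, Polynomial.coeff_C_mul, Polynomial.coeff_X_pow,
    Fin.val_inj, mul_ite, mul_one, mul_zero, Finset.sum_ite_eq, Finset.mem_univ, if_true,
    Polynomial.coeff_zero] at h1
  exact mul_ne_zero (sqrt_choose_ne_zero k) h h1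

theorem bottomPoly_ne_zero {f : SpinIndex A → ℂ} {i : SpinIndex A} (h : f i ≠ 0) :
    bottomPoly f i.1 ≠ 0 := by
  obtain ⟨x, k⟩ := i
  intro h0
  have h1 := congrArg (fun P => P.coeff (x.1 - (k : ℕ))) h0
  have hinj (l : Fin (x.1 + 1)) : x.1 - (k : ℕ) = x.1 - (l : ℕ) ↔ k = l := by
    rw [Fin.ext_iff]; omega
  simp only [bottomPoly, Polynomial.finsetSum_coeff, Polynomial.coeff_C_mul,
    Polynomial.coeff_X_pow, hinj, mul_ite, mul_one, mul_zero, Finset.sum_ite_eq, Finset.mem_univ,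
    if_true, Polynomial.coeff_zero] at h1
  exact mul_ne_zero (mul_ne_zero (sqrt_choose_ne_zero k) h) (by simp) h1

theorem rotate_realRotation_top (f : SpinIndex A → ℂ) (x : Σ n, A n) (t : ℝ) :
    ∃ c : ℂ, c ≠ 0 ∧ rotate (realRotation t) f ⟨x, 0⟩ = c * (topPoly f x).eval (t : ℂ) := by
  have hr : (√(1 + t ^ 2) : ℂ) ≠ 0 := by
    exact_mod_cast (Real.sqrt_pos.2 (by positivity : 0 < 1 + t ^ 2)).ne'
  refine ⟨(1 / √(1 + t ^ 2)) ^ x.1, pow_ne_zero _ (one_div_ne_zero hr), ?_⟩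
  rw [rotate, topPoly, Polynomial.eval_finsetSum, Finset.mul_sum]
  refine Finset.sum_congr rfl fun k _ => ?_
  have hk : (k : ℕ) ≤ x.1 := Nat.lt_succ_iff.1 k.2
  rw [spinMatrix_apply, Fin.val_zero, symCoeff_zero_left hk]
  have hx : ((1 : ℂ) / √(1 + t ^ 2)) ^ x.1 =
      (1 / √(1 + t ^ 2)) ^ (k : ℕ) * (1 / √(1 + t ^ 2)) ^ (x.1 - (k : ℕ)) := by
    rw [← pow_add, Nat.add_sub_cancel' hk]
  have hu : (realRotation t).1 0 0 = 1 / (√(1 + t ^ 2) : ℂ) := by simp [realRotation]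
  have hv : -conj ((realRotation t).1 1 0) = t * (1 / (√(1 + t ^ 2) : ℂ)) := by
    simp [realRotation]; ring
  rw [hx, hu, hv, mul_pow]
  simp only [Polynomial.eval_mul, Polynomial.eval_C, Polynomial.eval_pow, Polynomial.eval_X,
    Nat.choose_zero_right, Nat.cast_one, Real.sqrt_one, Complex.ofReal_one, div_one]
  ring

theorem rotate_realRotation_bottom (f : SpinIndex A → ℂ) (x : Σ n, A n) (t : ℝ) :
    ∃ c : ℂ, c ≠ 0 ∧
      rotate (realRotation t) f ⟨x, Fin.last _⟩ = c * (bottomPoly f x).eval (t : ℂ) := by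
  have hr : (√(1 + t ^ 2) : ℂ) ≠ 0 := by
    exact_mod_cast (Real.sqrt_pos.2 (by positivity : 0 < 1 + t ^ 2)).ne'
  refine ⟨(1 / √(1 + t ^ 2)) ^ x.1, pow_ne_zero _ (one_div_ne_zero hr), ?_⟩
  rw [rotate, bottomPoly, Polynomial.eval_finsetSum, Finset.mul_sum]
  refine Finset.sum_congr rfl fun k _ => ?_
  have hk : (k : ℕ) ≤ x.1 := Nat.lt_succ_iff.1 k.2
  rw [spinMatrix_apply, Fin.val_last, symCoeff_self_left hk]
  have hx : ((1 : ℂ) / √(1 + t ^ 2)) ^ x.1 =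
      (1 / √(1 + t ^ 2)) ^ (k : ℕ) * (1 / √(1 + t ^ 2)) ^ (x.1 - (k : ℕ)) := by
    rw [← pow_add, Nat.add_sub_cancel' hk]
  have hu : conj ((realRotation t).1 0 0) = 1 / (√(1 + t ^ 2) : ℂ) := by simp [realRotation]
  have hv : (realRotation t).1 1 0 = -1 * t * (1 / (√(1 + t ^ 2) : ℂ)) := by
    simp [realRotation]; ring
  rw [hx, hu, hv, mul_pow, mul_pow]
  simp only [Polynomial.eval_mul, Polynomial.eval_C, Polynomial.eval_pow, Polynomial.eval_X,
    Nat.choose_self, Nat.cast_one, Real.sqrt_one, Complex.ofReal_one, div_one]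
  ring

/-- The product is a nonzero polynomial, so it cannot vanish on the infinite set of reals. -/
theorem exists_real_eval_ne_zero {P Q : Polynomial ℂ} (hP : P ≠ 0) (hQ : Q ≠ 0) :
    ∃ t : ℝ, P.eval (t : ℂ) ≠ 0 ∧ Q.eval (t : ℂ) ≠ 0 := by
  by_contra! h
  refine mul_ne_zero hP hQ (Polynomial.eq_zero_of_infinite_isRoot _ ?_)
  refine (Set.infinite_range_of_injective Complex.ofReal_injective).mono ?_
  rintro _ ⟨t, rfl⟩
  rw [Set.mem_ofPred_eq, Polynomial.IsRoot, Polynomial.eval_mul, mul_eq_zero]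
  exact or_iff_not_imp_left.2 (h t)

theorem exists_rotate_top_ne_zero {f : SpinIndex A → ℂ} {f' : SpinIndex B → ℂ} {i : SpinIndex A}
    {i' : SpinIndex B} (h : f i ≠ 0) (h' : f' i' ≠ 0) :
    ∃ g, rotate g f ⟨i.1, 0⟩ ≠ 0 ∧ rotate g f' ⟨i'.1, 0⟩ ≠ 0 := by
  obtain ⟨t, h1, h2⟩ := exists_real_eval_ne_zero (topPoly_ne_zero h) (topPoly_ne_zero h')
  obtain ⟨c, hc, e⟩ := rotate_realRotation_top f i.1 t
  obtain ⟨c', hc', e'⟩ := rotate_realRotation_top f' i'.1 t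
  exact ⟨_, e ▸ mul_ne_zero hc h1, e' ▸ mul_ne_zero hc' h2⟩

theorem exists_rotate_top_bottom_ne_zero {f : SpinIndex A → ℂ} {i : SpinIndex A} (h : f i ≠ 0) :
    ∃ g, rotate g f ⟨i.1, 0⟩ ≠ 0 ∧ rotate g f ⟨i.1, Fin.last _⟩ ≠ 0 := by
  obtain ⟨t, h1, h2⟩ := exists_real_eval_ne_zero (topPoly_ne_zero h) (bottomPoly_ne_zero h)
  obtain ⟨c, hc, e⟩ := rotate_realRotation_top f i.1 t
  obtain ⟨c', hc', e'⟩ := rotate_realRotation_bottom f i.1 t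
  exact ⟨_, e ▸ mul_ne_zero hc h1, e' ▸ mul_ne_zero hc' h2⟩

/-! ### Occupied spins and the maximal spin -/

theorem summable_spinWeight (ψ : PureState A) (n : ℕ) :
    Summable fun i => if i.1.1 = n then ‖ψ.amp i‖ ^ 2 else 0 := by
  refine Summable.of_nonneg_of_le (fun i => ?_) (fun i => ?_) ψ.normalized.summable <;>
    split_ifs <;> first | positivity | exact le_rfl

theorem spinWeight_pos_iff (ψ : PureState A) (n : ℕ) :
    0 < spinWeight ψ n ↔ ∃ i, i.1.1 = n ∧ ψ.amp i ≠ 0 := by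
  have hnn (i : SpinIndex A) : 0 ≤ if i.1.1 = n then ‖ψ.amp i‖ ^ 2 else 0 := by
    split_ifs <;> positivity
  constructor
  · intro h
    by_contra! h0
    refine h.ne' ((tsum_congr fun i => ?_).trans tsum_zero)
    split_ifs with hi
    · simp [h0 i hi]
    · rfl
  · rintro ⟨i, hi, h⟩
    refine (summable_spinWeight ψ n).tsum_pos hnn i ?_
    rw [if_pos hi]
    positivity

/-- The values `2j` of the occupied spins `j`. -/
def occupied (ψ : PureState A) : Set ℕ := {n | ∃ i, i.1.1 = n ∧ ψ.amp i ≠ 0}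

theorem occupiedSpins_eq (ψ : PureState A) :
    occupiedSpins ψ = (fun n : ℕ => (n : ℝ) / 2) '' occupied ψ := by
  ext j
  simp only [occupiedSpins, Set.mem_ofPred_eq, spinWeight_pos_iff, Set.mem_image, occupied]
  exact exists_congr fun n => by rw [and_comm, eq_comm]

theorem occupied_nonempty (ψ : PureState A) : (occupied ψ).Nonempty := by
  by_contra h
  have h0 (i : SpinIndex A) : ψ.amp i = 0 := by
    by_contra hi
    exact h ⟨_, i, rfl, hi⟩
  have := ψ.normalized.tsum_eq
  simp [h0] at this

theorem bddAbove_occupiedSpins_iff (ψ : PureState A) :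
    BddAbove (occupiedSpins ψ) ↔ BddAbove (occupied ψ) := by
  rw [occupiedSpins_eq]
  constructor
  · rintro ⟨c, hc⟩
    refine ⟨⌈2 * c⌉₊, fun n hn => ?_⟩
    have h1 : (n : ℝ) / 2 ≤ c := hc (Set.mem_image_of_mem _ hn)
    have h2 := Nat.le_ceil (2 * c)
    have : (n : ℝ) ≤ ⌈2 * c⌉₊ := by linarith
    exact_mod_cast this
  · rintro ⟨N, hN⟩
    refine ⟨(N : ℝ) / 2, ?_⟩
    rintro _ ⟨n, hn, rfl⟩
    have : (n : ℝ) ≤ N := by exact_mod_cast hN hn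
    simp only
    linarith

theorem exists_isGreatest_occupied {ψ : PureState A} (h : BddAbove (occupied ψ)) :
    ∃ N, IsGreatest (occupied ψ) N ∧ jmax ψ = (N : ℝ) / 2 := by
  have hN : IsGreatest (occupied ψ) (sSup (occupied ψ)) :=
    ⟨Nat.sSup_mem (occupied_nonempty ψ) h, fun n hn => le_csSup h hn⟩
  refine ⟨_, hN, IsGreatest.csSup_eq ?_⟩
  rw [occupiedSpins_eq]
  refine ⟨⟨_, hN.1, rfl⟩, ?_⟩
  rintro _ ⟨n, hn, rfl⟩
  have : (n : ℝ) ≤ (sSup (occupied ψ) : ℕ) := by exact_mod_cast hN.2 hn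
  simp only
  linarith

theorem mem_occupied_of_rotate_ne_zero {ψ : PureState A} {g : SU2} {i : SpinIndex A}
    (h : rotate g ψ.amp i ≠ 0) : i.1.1 ∈ occupied ψ := by
  obtain ⟨k, -, hk⟩ := Finset.exists_ne_zero_of_sum_ne_zero h
  exact ⟨⟨i.1, k⟩, rfl, right_ne_zero_of_mul hk⟩

theorem abs_weight_le_of_rotate_ne_zero {ψ : PureState A} {N : ℕ}
    (hN : N ∈ upperBounds (occupied ψ)) {g : SU2} {i : SpinIndex A}
    (h : rotate g ψ.amp i ≠ 0) : |weight i| ≤ N :=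
  (abs_weight_le i).trans (by exact_mod_cast hN (mem_occupied_of_rotate_ne_zero h))

theorem weight_top (x : Σ n, A n) : weight (⟨x, 0⟩ : SpinIndex A) = x.1 := by simp [weight]

theorem weight_bottom (x : Σ n, A n) : weight (⟨x, Fin.last _⟩ : SpinIndex A) = -x.1 := by
  simp [weight]; ring

/-! ### The criteria for characteristic functions -/

theorem summable_norm_sq_mul_norm_sq (ξ : PureState A) (φ : PureState B) (g : SU2) :
    Summable fun y : SpinIndex A × SpinIndex B =>
      ‖rotate g ξ.amp y.1‖ ^ 2 * ‖rotate g φ.amp y.2‖ ^ 2 :=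
  Summable.mul_of_nonneg (f := fun i => ‖rotate g ξ.amp i‖ ^ 2)
    (g := fun i => ‖rotate g φ.amp i‖ ^ 2) (summable_norm_rotate_sq ξ g)
    (summable_norm_rotate_sq φ g) (fun i => sq_nonneg ‖rotate g ξ.amp i‖)
    (fun i => sq_nonneg ‖rotate g φ.amp i‖)

theorem charFun_mul_conj_torus (ξ : PureState A) (φ : PureState B) (g : SU2) (z : Circle) :
    charFun ξ (g⁻¹ * (torus z * g)) * charFun φ (g⁻¹ * (torus z * g)) =
      ∑' y : SpinIndex A × SpinIndex B, (z : ℂ) ^ (weight y.1 + weight y.2) *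
        ((‖rotate g ξ.amp y.1‖ ^ 2 * ‖rotate g φ.amp y.2‖ ^ 2 : ℝ) : ℂ) := by
  rw [charFun_conj_torus, charFun_conj_torus, tsum_mul_tsum_of_summable_norm
    (summable_zpow_mul (summable_norm_rotate_sq ξ g) _ z).norm
    (summable_zpow_mul (summable_norm_rotate_sq φ g) _ z).norm]
  refine tsum_congr fun y => ?_
  rw [zpow_add₀ (Circle.coe_ne_zero z), Complex.ofReal_mul]
  ring

/-- Occupied spins of `ξ` and `φ` add up to at most the maximal spin of `ψ`, and those of `σ` are
bounded by it, if `χ_ψ` is a nonnegative combination of `χ_ξ χ_φ` and `χ_σ`. -/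
theorem occupied_le_of_charFun_eq {ψ : PureState A} {φ : PureState B} {ξ : PureState C}
    {σ : PureState D} {p r : ℝ} (hp : 0 < p) (hr : 0 ≤ r) {N : ℕ}
    (hN : N ∈ upperBounds (occupied ψ))
    (H : ∀ g, charFun ψ g = p * charFun ξ g * charFun φ g + r * charFun σ g) :
    (∀ n ∈ occupied ξ, ∀ m ∈ occupied φ, n + m ≤ N) ∧
      (0 < r → ∀ l ∈ occupied σ, l ≤ N) := by
  have key (g : SU2) : (∀ y : SpinIndex C × SpinIndex B, (N : ℤ) < weight y.1 + weight y.2 →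
        p * (‖rotate g ξ.amp y.1‖ ^ 2 * ‖rotate g φ.amp y.2‖ ^ 2) = 0) ∧
      ∀ i : SpinIndex D, (N : ℤ) < weight i → r * ‖rotate g σ.amp i‖ ^ 2 = 0 := by
    refine eq_zero_of_fourier_eq (summable_norm_rotate_sq ψ g)
      (summable_norm_sq_mul_norm_sq ξ φ g) (summable_norm_rotate_sq σ g)
      (fun _ => mul_nonneg (sq_nonneg _) (sq_nonneg _)) (fun _ => sq_nonneg _)
      hp.le hr (w := weight) (fun z => ?_) (N := N) (fun i hi => ?_)
    · rw [← charFun_conj_torus, H, ← charFun_conj_torus σ, mul_assoc, charFun_mul_conj_torus]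
    · exact abs_weight_le_of_rotate_ne_zero hN (g := g) fun h => hi (by simp [h])
  constructor
  · rintro _ ⟨i, rfl, hi⟩ _ ⟨j, rfl, hj⟩
    -- For this `g` the product series has a positive coefficient at the sum of the two top weights.
    obtain ⟨g, h1, h2⟩ := exists_rotate_top_ne_zero hi hj
    by_contra hlt
    have h := (key g).1 (⟨i.1, 0⟩, ⟨j.1, 0⟩) (by simp only [weight_top]; omega)
    simp [hp.ne', h1, h2] at h
  · rintro hr' _ ⟨i, rfl, hi⟩
    obtain ⟨g, h1, -⟩ := exists_rotate_top_ne_zero hi hi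
    by_contra hlt
    have h := (key g).2 ⟨i.1, 0⟩ (by simp only [weight_top]; omega)
    simp [hr'.ne', h1] at h

/-- A unit vector occupies some spin, so one element of either occupied set bounds the other; the
inequality then comes from the two maxima. -/
theorem jmax_le_sub {ψ : PureState A} {φ : PureState B} {ξ : PureState C} {N : ℕ}
    (hψ : jmax ψ = (N : ℝ) / 2)
    (h : ∀ n ∈ occupied ξ, ∀ m ∈ occupied φ, n + m ≤ N) :
    BddAbove (occupied φ) ∧ BddAbove (occupied ξ) ∧ jmax ξ ≤ jmax ψ - jmax φ := by
  obtain ⟨n, hn⟩ := occupied_nonempty ξ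
  obtain ⟨m, hm⟩ := occupied_nonempty φ
  have h1 : BddAbove (occupied φ) := ⟨N, fun k hk => by have := h n hn k hk; omega⟩
  have h2 : BddAbove (occupied ξ) := ⟨N, fun k hk => by have := h k hk m hm; omega⟩
  obtain ⟨a, ha, e1⟩ := exists_isGreatest_occupied h1
  obtain ⟨b, hb, e2⟩ := exists_isGreatest_occupied h2
  refine ⟨h1, h2, ?_⟩
  have : (b : ℝ) + a ≤ N := by exact_mod_cast h b hb.1 a ha.1
  rw [e1, e2, hψ]
  linarith

/-! ### Modes of density matrices under covariant operations -/

theorem rep_mul_density_mul [Fintype (SpinIndex A)] (ψ : PureState A) (g : SU2) :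
    rep A g * densityMatrix ψ * (rep A g).conjTranspose =
      Matrix.of fun i j => rotate g ψ.amp i * conj (rotate g ψ.amp j) := by
  have h1 : (rep A g).mulVec ψ.amp = rotate g ψ.amp := by
    funext i
    rw [← tsum_rep_mul, tsum_fintype]; rfl
  have h2 : densityMatrix ψ = Matrix.vecMulVec ψ.amp (star ψ.amp) := rfl
  rw [h2, Matrix.mul_vecMulVec, Matrix.vecMulVec_mul, ← Matrix.star_mulVec, h1]
  rfl

theorem bddAbove_occupied [Fintype (SpinIndex A)] (ψ : PureState A) :
    BddAbove (occupied ψ) := by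
  refine Set.Finite.bddAbove ((Set.finite_range fun i : SpinIndex A => i.1.1).subset ?_)
  rintro n ⟨i, hi, -⟩
  exact ⟨i, hi⟩

/-- The entry `(a, b)` of a rotated density matrix has torus frequency `weight a - weight b`. The
mode filter is a finite sum, so it passes through a linear map by additivity alone. -/
theorem sum_zpow_mul_rotate_mul_conj {M : ℕ} {ζ : Circle}
    (hζ : ∀ d : ℤ, ∑ s ∈ Finset.range M, ((ζ ^ s : Circle) : ℂ) ^ d =
      if (M : ℤ) ∣ d then (M : ℂ) else 0) (l : ℤ) (g : SU2) (f : SpinIndex A → ℂ)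
    (a b : SpinIndex A) :
    ∑ s ∈ Finset.range M, ((ζ ^ s : Circle) : ℂ) ^ (-l) *
        (rotate (torus (ζ ^ s) * g) f a * conj (rotate (torus (ζ ^ s) * g) f b)) =
      (if (M : ℤ) ∣ weight a - weight b - l then (M : ℂ) else 0) *
        (rotate g f a * conj (rotate g f b)) := by
  rw [← hζ, Finset.sum_mul]
  refine Finset.sum_congr rfl fun s _ => ?_
  have hz := Circle.coe_ne_zero (ζ ^ s)
  have hc : conj (((ζ ^ s : Circle) : ℂ) ^ weight b) = ((ζ ^ s : Circle) : ℂ) ^ (-weight b) := by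
    rw [map_zpow₀, ← Circle.coe_inv_eq_conj, Circle.coe_inv, inv_zpow, zpow_neg]
  rw [rotate_torus_mul, rotate_torus_mul, map_mul, hc,
    show weight a - weight b - l = -l + weight a + -weight b by ring, zpow_add₀ hz,
    zpow_add₀ hz]
  ring

theorem occupied_le_of_convertible [Fintype (SpinIndex A)] [Fintype (SpinIndex B)]
    {ψ : PureState A} {φ : PureState B} {p : ℝ} (hp : 0 < p)
    (H : CovariantlyConvertible ψ φ p) {N : ℕ} (hN : N ∈ upperBounds (occupied ψ)) {m : ℕ}
    (hm : m ∈ occupied φ) : m ≤ N := by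
  obtain ⟨E, hE, hEψ⟩ := H
  obtain ⟨i, rfl, hi⟩ := hm
  obtain ⟨g, ht, hb⟩ := exists_rotate_top_bottom_ne_zero hi
  by_contra! hlt
  set l : ℤ := 2 * i.1.1 with hl
  -- The modulus exceeds `2N + l`, the largest possible `|weight a - weight b - l|` for `ψ`, so
  -- divisibility would force equality with `l > 2N`.
  obtain ⟨ζ, hζ⟩ := exists_circle_sum_zpow (2 * N + 2 * i.1.1 + 1) (by omega)
  set M := 2 * N + 2 * i.1.1 + 1 with hM
  have hE1 (h : SU2) : E (Matrix.of fun a b => rotate h ψ.amp a * conj (rotate h ψ.amp b)) =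
      (p : ℂ) • Matrix.of fun a b => rotate h φ.amp a * conj (rotate h φ.amp b) := by
    rw [← rep_mul_density_mul, hE.covariant, hEψ, Matrix.mul_smul, Matrix.smul_mul,
      rep_mul_density_mul]
  have hzero : ∑ s ∈ Finset.range M, ((ζ ^ s : Circle) : ℂ) ^ (-l) •
      (Matrix.of fun a b => rotate (torus (ζ ^ s) * g) ψ.amp a *
        conj (rotate (torus (ζ ^ s) * g) ψ.amp b)) = 0 := by
    ext a b
    simp only [Matrix.sum_apply, Matrix.smul_apply, Matrix.of_apply, smul_eq_mul,
      sum_zpow_mul_rotate_mul_conj hζ,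
      Matrix.zero_apply]
    by_contra hne
    have h2 := right_ne_zero_of_mul hne
    have ha := abs_le.1 (abs_weight_le_of_rotate_ne_zero hN (left_ne_zero_of_mul h2))
    have hb := abs_le.1 (abs_weight_le_of_rotate_ne_zero hN
      (fun h => right_ne_zero_of_mul h2 (by rw [h, map_zero])))
    refine hne ?_
    rw [if_neg, zero_mul]
    intro hd
    have := Int.eq_zero_of_abs_lt_dvd hd (by rw [abs_lt]; omega)
    omega
  -- Applying `E` to the vanishing mode `l` of `ψ` gives the filtered sum for `φ`, whose top-bottom
  -- entry is a product of nonzero factors.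
  have hfin := congrArg (fun X => E X ⟨i.1, 0⟩ ⟨i.1, Fin.last _⟩) hzero
  simp only [map_sum, map_smul, hE1, map_zero, Matrix.sum_apply, Matrix.smul_apply,
    Matrix.of_apply, smul_eq_mul, mul_left_comm _ (p : ℂ), ← Finset.mul_sum,
    sum_zpow_mul_rotate_mul_conj hζ, weight_top,
    weight_bottom, Matrix.zero_apply] at hfin
  rw [if_pos (by rw [hl]; ring_nf; exact dvd_zero _)] at hfin
  have hM0 : (M : ℂ) ≠ 0 := by norm_cast
  simp [hp.ne', hM0, ht, hb] at hfin

end SpinCovariance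

end

open SpinCovariance in
theorem mainTheorem6 {A B C D : ℕ → Type*} (ψ : PureState A) (φ : PureState B) :
    -- deterministic criterion
    (∀ ξ : PureState C, BddAbove (occupiedSpins ψ) →
      (∀ g : SU2, charFun ψ g = charFun ξ g * charFun φ g) →
        BddAbove (occupiedSpins φ) ∧ BddAbove (occupiedSpins ξ) ∧
          jmax ξ ≤ jmax ψ - jmax φ) ∧
    -- probabilistic criterion
    (∀ (ξ : PureState C) (σ : PureState D) (p : ℝ), 0 < p → p < 1 →
      BddAbove (occupiedSpins ψ) →
      (∀ g : SU2, charFun ψ g =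
        (p : ℂ) * charFun ξ g * charFun φ g + (1 - (p : ℂ)) * charFun σ g) →
        BddAbove (occupiedSpins φ) ∧ BddAbove (occupiedSpins ξ) ∧
          BddAbove (occupiedSpins σ) ∧
          jmax ξ ≤ jmax ψ - jmax φ ∧ jmax σ ≤ jmax ψ) ∧
    -- no increase of the maximal spin under probabilistic transformations
    (∀ [Fintype (SpinIndex A)] [Fintype (SpinIndex B)] (p : ℝ), 0 < p →
      CovariantlyConvertible ψ φ p → jmax φ ≤ jmax ψ) := by
  simp only [bddAbove_occupiedSpins_iff]
  refine ⟨fun ξ hψ H => ?_, fun ξ σ p hp hp1 hψ H => ?_, fun p hp H => ?_⟩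
  · obtain ⟨N, hN, hj⟩ := exists_isGreatest_occupied hψ
    -- The deterministic case is `p = 1`, `r = 0`; here `σ` has coefficient zero, and `ψ` merely
    -- fills its place.
    exact jmax_le_sub hj (occupied_le_of_charFun_eq (σ := ψ) one_pos le_rfl hN.2
      (fun g => by simp [H])).1
  · obtain ⟨N, hN, hj⟩ := exists_isGreatest_occupied hψ
    obtain ⟨h1, h2⟩ := occupied_le_of_charFun_eq (ξ := ξ) (φ := φ) (σ := σ) (r := 1 - p) hp (by linarith) hN.2
      (fun g => by rw [H, Complex.ofReal_sub, Complex.ofReal_one])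
    obtain ⟨b1, b2, h3⟩ := jmax_le_sub hj h1
    have b3 : BddAbove (occupied σ) := ⟨N, h2 (by linarith)⟩
    obtain ⟨l, hl, e⟩ := exists_isGreatest_occupied b3
    have : (l : ℝ) ≤ N := by exact_mod_cast h2 (by linarith) l hl.1
    exact ⟨b1, b2, b3, h3, by rw [e, hj]; linarith⟩
  · obtain ⟨N, hN, hj⟩ := exists_isGreatest_occupied (bddAbove_occupied ψ)
    obtain ⟨m, hm, e⟩ := exists_isGreatest_occupied (bddAbove_occupied φ)
    have : (m : ℝ) ≤ N := by exact_mod_cast occupied_le_of_convertible hp H hN.2 hm.1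
    rw [e, hj]
    linarith
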